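/- **Notation.** For a partition $\lambda=(\lambda_1\ge\dots\ge\lambda_r)$ of $n\ge1$ put $l(\lambda)=r$, $n(\lambda)=\sum_{i}(i-1)\lambda_i$, and $m(\lambda)!=\prod_j r_j!$, where $r_j$ is the number of parts of $\lambda$ equal to $j$. Consider the specialization of symmetric functions (over $\mathbb{Q}$, with values in $\mathbb{Q}[q]$) that sends the elementary symmetric function $e_k$ to $q^{\binom k2}/k!$ for $k\ge1$, and let $[m_\lambda]$ be the image of the monomial symmetric function $m_\lambda$. The polynomial $J_\lambda(q)$ is the quotient determined by $$(n-1)!\,m(\lambda)!\,[m_\lambda]=(1-q)^{\,n-l(\lambda)}\,q^{\,n(\lambda)}\,J_\lambda(q),\tag{1}$$ and $$P_\lambda(t)=n\,t^n\,\frac{(1+t)^{n(\lambda)}}{m(\lambda)!}\,J_\lambda(1+t).$$ Let $K_{n+1}$ be the complete graph on $\{1,\dots,n+1\}$ with root $1$, and let $\mathcal P_n^{(s)}$ be the set of spanning connected subgraphs $C$ of $K_{n+1}$ in which the root has degree $s$. The depth-first search of such a $C$ starts at $1$ and at each step goes to the greatest unvisited vertex adjacent to the current vertex if there is one, and otherwise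 backtracks. Let $w(C)$ be the word formed by the vertices other than $1$ in the order in which they are first visited. Cut $w(C)$ in front of every letter that is adjacent to $1$ in $C$, and let $\Lambda(C)$ be the partition of $n$ whose parts are the lengths of the resulting subwords. For a partition $\lambda$ of $n$ with $l(\lambda)=s$ let $\mathcal P_\lambda$ be the set of $C\in\mathcal P_n^{(s)}$ with $\Lambda(C)=\lambda$, and let $e(C)$ be the number of edges of $C$. **Theorem.** Let $n\ge1$ and let $\lambda$ be a partition of $n$ of one of the types $(n)$, $1^n=(1,\dots,1)$, or, for $n\ge2$, $1^{n-2}2=(2,1,\dots,1)$. Then the division in (1) is exact, so that $J_\lambda\in\mathbb{Q}[q]$ satisfies (1), and $$P_\lambda(t)=\sum_{C\in\mathcal P_\lambda}t^{e(C)} .$$ Moreover $\mathcal P_{(n)}=\mathcal P_n^{(1)}$ and $\mathcal P_{1^n}=\mathcal P_n^{(n)}$ for $n\ge1$, and $\mathcal P_{1^{n-2}2}=\mathcal P_n^{(n-1)}$ for $n\ge2$. -/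

import Mathlib

open Polynomial

/-! ### Depth-first search on graphs with vertex set `{1, …, n+1}`

The vertex `i + 1` of `K_{n+1}` is the element `i : Fin (n + 1)`, so the root `1` is `0`.
A spanning subgraph of `K_{n+1}` is a `SimpleGraph (Fin (n + 1))`. -/

/-- The sequence of vertices entered from now on by the depth-first search of `C`, when `visited`
is the set of visited vertices and the list is the path from the current vertex (its head) back to
the root: go to the greatest unvisited vertex adjacent to the current vertex if there is one,
otherwise backtrack by one vertex. The search ends when all vertices have been visited (or when
it would have to backtrack from the root); the first argument bounds the number of moves. -/
def dfsFrom {n : ℕ} (C : SimpleGraph (Fin (n + 1))) [DecidableRel C.Adj] :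
    ℕ → Finset (Fin (n + 1)) → List (Fin (n + 1)) → List (Fin (n + 1))
  | 0, _, _ => []
  | _ + 1, _, [] => []
  | k + 1, visited, v :: path =>
    if visited = Finset.univ then []
    else if h : (Finset.univ.filter fun u => C.Adj v u ∧ u ∉ visited).Nonempty then
      let u := (Finset.univ.filter fun u => C.Adj v u ∧ u ∉ visited).max' h
      u :: dfsFrom C k (insert u visited) (u :: v :: path)
    else
      match path with
      | [] => []
      | u :: rest => u :: dfsFrom C k visited (u :: rest)

/-- The sequence `τ(C)` of vertices read in the order of the depth-first search started at the
root. Each of the at most `n` edges of the search tree is used at most once in each direction, so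
that `2 * n` moves always suffice. -/
def dfsSeq {n : ℕ} (C : SimpleGraph (Fin (n + 1))) [DecidableRel C.Adj] : List (Fin (n + 1)) :=
  0 :: dfsFrom C (2 * n) {0} [0]

/-- The word `w(C)`: only the first occurrence of each letter of `τ(C)` is kept (`List.dedup`
keeps the last occurrences, whence the two reversals), and the root is deleted. -/
def dfsWord {n : ℕ} (C : SimpleGraph (Fin (n + 1))) [DecidableRel C.Adj] : List (Fin (n + 1)) :=
  (dfsSeq C).reverse.dedup.reverse.filter fun v => decide (v ≠ 0)

/-- The subwords of `w(C)` obtained by cutting `w(C)` in front of each letter adjacent to the root: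
two consecutive letters `a b` stay together exactly when `b` is not adjacent to the root. -/
def dfsSubwords {n : ℕ} (C : SimpleGraph (Fin (n + 1))) [DecidableRel C.Adj] :
    List (List (Fin (n + 1))) :=
  (dfsWord C).splitBy fun _ b => decide (¬ C.Adj 0 b)

/-- The partition `Λ(C)`, as the multiset of its parts: the lengths of the subwords. -/
def dfsParts {n : ℕ} (C : SimpleGraph (Fin (n + 1))) [DecidableRel C.Adj] : Multiset ℕ :=
  ((dfsSubwords C).map List.length : List ℕ)

noncomputable section

open Classical in
/-- `𝒫_n^{(s)}`: the spanning connected subgraphs of `K_{n+1}` in which the root has degree `s`. -/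
def rootDegreeGraphs (n s : ℕ) : Finset (SimpleGraph (Fin (n + 1))) :=
  Finset.univ.filter fun C => C.Connected ∧ C.degree 0 = s

open Classical in
/-- `𝒫_λ`: the graphs `C` in `𝒫_n^{(s)}`, with `s` the length of `λ`, such that `Λ(C) = λ`. -/
def dfsGraphs {n : ℕ} (lam : n.Partition) : Finset (SimpleGraph (Fin (n + 1))) :=
  (rootDegreeGraphs n lam.parts.card).filter fun C => dfsParts C = lam.parts

open Classical in
/-- The edge enumerator `∑_{C ∈ S} t ^ e(C)` of a set of graphs. -/
def edgeEnumerator {n : ℕ} (S : Finset (SimpleGraph (Fin (n + 1)))) : ℚ[X] :=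
  ∑ C ∈ S, X ^ C.edgeFinset.card

/-! ### The polynomials `J_λ` and `P_λ` -/

/-- `n(λ) = ∑ (i - 1) λ_i`, the parts `λ_1 ≥ λ_2 ≥ …` being in non-increasing order. -/
def partitionWeight {n : ℕ} (lam : n.Partition) : ℕ :=
  ((lam.parts.sort (· ≥ ·)).mapIdx fun i a => i * a).sum

/-- `m(λ)! = ∏_j r_j !`, where `r_j` is the number of parts of `λ` equal to `j`. -/
def multFactorial {n : ℕ} (lam : n.Partition) : ℕ :=
  ∏ j ∈ lam.parts.toFinset, (lam.parts.count j).factorial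

/-- The specialization of symmetric functions determined by `e_k ↦ q ^ (k choose 2) / k !`, that is
`∑ e_k z ^ k ↦ ∑ q ^ (k choose 2) z ^ k / k !`, on the symmetric polynomials in `n` variables
(which are freely generated by `e_1, …, e_n`). The indeterminate of `ℚ[X]` is `q`. -/
def specialization (n : ℕ) : MvPolynomial.symmetricSubalgebra (Fin n) ℚ →ₐ[ℚ] ℚ[X] :=
  (MvPolynomial.aeval fun i : Fin n =>
      C (1 / ((i.val + 1).factorial : ℚ)) * (X : ℚ[X]) ^ (i.val + 1).choose 2).comp
    (MvPolynomial.esymmAlgEquiv (R := ℚ) (σ := Fin n) (n := n) (Fintype.card_fin n)).symm.toAlgHom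

/-- The image of the monomial symmetric function `m_λ` under `specialization`. Since `λ` is a
partition of `n`, the expression of `m_λ` through the `e_k` can be read off in `n` variables. -/
def specializedMonomial {n : ℕ} (lam : n.Partition) : ℚ[X] :=
  specialization n ⟨MvPolynomial.msymm (Fin n) ℚ lam, MvPolynomial.msymm_isSymmetric _ _ lam⟩

/-- The equation
`(n-1)! m(λ)! m_λ = (1 - q) ^ (n - l(λ)) q ^ n(λ) J`
for the specialized monomial symmetric function, which characterizes `J = J_λ`. -/
def IsMonomialJ {n : ℕ} (lam : n.Partition) (J : ℚ[X]) : Prop :=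
  C (((n - 1).factorial * multFactorial lam : ℕ) : ℚ) * specializedMonomial lam =
    (1 - X) ^ (n - lam.parts.card) * X ^ partitionWeight lam * J

/-- `J_λ(q)`, as the quotient solving the equation in `IsMonomialJ`. -/
def monomialJ {n : ℕ} (lam : n.Partition) : ℚ[X] :=
  C (((n - 1).factorial * multFactorial lam : ℕ) : ℚ) * specializedMonomial lam /
    ((1 - X) ^ (n - lam.parts.card) * X ^ partitionWeight lam)

/-- `P_λ(t) = n t ^ n (1 + t) ^ n(λ) J_λ(1 + t) / m(λ)!`. -/
def polyP {n : ℕ} (lam : n.Partition) : ℚ[X] :=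
  C ((n : ℚ) / (multFactorial lam : ℚ)) * X ^ n * (1 + X) ^ partitionWeight lam *
    (monomialJ lam).comp (1 + X)

end

/-!
Each of `(n)`, `1ⁿ` and `1ⁿ⁻²2` is the only partition of `n` with its number of parts.
Every neighbour of the root opens a new subword of `w(C)`, and the first letter of `w(C)` is one, so
`Λ(C)` has as many parts as the degree of the root, and `𝒫_λ` consists of all graphs whose root has
degree `l(λ)`. Deleting the root of such a graph leaves a graph on `n` vertices each of whose
components meets the set `A` of neighbours of the root: a connected graph if `|A| = 1`, any graph if
`|A| = n`, and a graph in which the vertex outside `A` is not isolated if `|A| = n - 1`.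

On the algebraic side `m_λ` is `p_n`, `e_n` or `p_1 e_{n-1} - n e_n`, respectively. Only `p_n` has
no evident image: after the specialization, Newton's identities become the recursion that splits off
the component of a vertex from an arbitrary graph, so `p_n` goes to
`(-1)ⁿ⁻¹ ∑ (q - 1) ^ e(G) / (n - 1)!`, summed over the connected graphs `G` on `n` vertices.
-/

/-! ### The depth-first search of a connected graph -/

theorem mem_of_reachable_of_adj_closed {V : Type*} {G : SimpleGraph V} {s : Set V}
    (hs : ∀ x ∈ s, ∀ y, G.Adj x y → y ∈ s) {x y : V} (h : G.Reachable x y) (hx : x ∈ s) :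
    y ∈ s := by
  obtain ⟨w⟩ := h
  induction w with
  | nil => exact hx
  | cons hadj _ ih => exact ih (hs _ hx _ hadj)

/-- The invariant of depth-first search: the vertices of the current path are visited, and a
visited vertex that the path has left for good has only visited neighbours. -/
structure DfsInvariant {V : Type*} (G : SimpleGraph V) (visited : Finset V) (path : List V) :
    Prop where
  mem_visited : ∀ v ∈ path, v ∈ visited
  adj_closed : ∀ v ∈ visited, v ∉ path → ∀ u, G.Adj v u → u ∈ visited

namespace DfsInvariant

variable {V : Type*} {G : SimpleGraph V} {visited : Finset V} {path : List V}

theorem start (v : V) : DfsInvariant G {v} [v] where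
  mem_visited := by simp
  adj_closed := by simp

theorem visit [DecidableEq V] (h : DfsInvariant G visited path) (u : V) :
    DfsInvariant G (insert u visited) (u :: path) where
  mem_visited v hv := by
    rcases List.mem_cons.1 hv with rfl | hv
    · exact Finset.mem_insert_self _ _
    · exact Finset.mem_insert_of_mem (h.mem_visited v hv)
  adj_closed v hv hpath y hy := by
    obtain ⟨hvu, hpath⟩ := not_or.1 (mt List.mem_cons.2 hpath)
    exact Finset.mem_insert_of_mem
      (h.adj_closed v (Finset.mem_of_mem_insert_of_ne hv hvu) hpath y hy)

theorem backtrack {v : V} (h : DfsInvariant G visited (v :: path))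
    (hv : ∀ u, G.Adj v u → u ∈ visited) : DfsInvariant G visited path where
  mem_visited u hu := h.mem_visited u (List.mem_cons_of_mem v hu)
  adj_closed u hu hpath y hy := by
    by_cases huv : u = v
    · exact hv y (huv ▸ hy)
    · exact h.adj_closed u hu (by simp [huv, hpath]) y hy

theorem eq_univ [Fintype V] (h : DfsInvariant G visited []) (hG : G.Preconnected)
    (hne : visited.Nonempty) : visited = Finset.univ := by
  obtain ⟨a, ha⟩ := hne
  exact Finset.eq_univ_of_forall fun b => mem_of_reachable_of_adj_closed (s := visited)
    (fun v hv => h.adj_closed v hv List.not_mem_nil) (hG a b) ha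

end DfsInvariant

section DepthFirstSearch

variable {n : ℕ} {C : SimpleGraph (Fin (n + 1))} [DecidableRel C.Adj]

-- The bound on `k`: each unvisited vertex still costs a step down and a step back up.
theorem mem_dfsFrom (hC : C.Connected) {x : Fin (n + 1)} {k : ℕ} {visited : Finset (Fin (n + 1))}
    {v : Fin (n + 1)} {path : List (Fin (n + 1))} (hinv : DfsInvariant C visited (v :: path))
    (hk : 2 * visitedᶜ.card + path.length ≤ k) (hx : x ∉ visited) :
    x ∈ dfsFrom C k visited (v :: path) := by
  induction k generalizing visited v path with
  | zero => simp_all [Finset.eq_empty_iff_forall_notMem]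
  | succ k ih =>
    have huniv : visited ≠ Finset.univ := fun h => hx (h ▸ Finset.mem_univ x)
    rw [dfsFrom, if_neg huniv]
    split_ifs with hnext
    · obtain ⟨-, -, hu⟩ := Finset.mem_filter.1 (Finset.max'_mem _ hnext)
      set u := Finset.max' _ hnext
      rw [List.mem_cons, or_iff_not_imp_left]
      refine fun hxu => ih (hinv.visit u) ?_ (by simp [hxu, hx])
      have hcard : visitedᶜ.card = (insert u visited)ᶜ.card + 1 := by
        rw [Finset.compl_insert, Finset.card_erase_add_one (Finset.mem_compl.2 hu)]
      rw [List.length_cons]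
      omega
    · have hinv' : DfsInvariant C visited path := hinv.backtrack fun u hu => by
        by_contra hvisited
        exact hnext ⟨u, by simp [hu, hvisited]⟩
      cases path with
      | nil => exact absurd (hinv'.eq_univ hC.preconnected ⟨v, hinv.mem_visited v (by simp)⟩) huniv
      | cons u rest =>
        rw [List.length_cons] at hk
        exact List.mem_cons_of_mem u (ih hinv' (by omega) hx)

theorem mem_dfsSeq (hC : C.Connected) (x : Fin (n + 1)) : x ∈ dfsSeq C := by
  rw [dfsSeq, List.mem_cons, or_iff_not_imp_left]
  exact fun hx => mem_dfsFrom hC (.start 0) (by simp [Finset.card_compl]) (by simpa using hx)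

theorem exists_dfsSeq_eq (hn : 1 ≤ n) (hC : C.Connected) :
    ∃ u l, C.Adj 0 u ∧ dfsSeq C = 0 :: u :: l := by
  obtain ⟨m, rfl⟩ := Nat.exists_eq_add_of_le' hn
  have huniv : ({0} : Finset (Fin (m + 1 + 1))) ≠ Finset.univ := fun h => by
    simpa using congrArg Finset.card h
  have hlast := mem_dfsSeq hC (Fin.last (m + 1))
  rw [dfsSeq, show 2 * (m + 1) = 2 * m + 1 + 1 by ring, dfsFrom, if_neg huniv] at hlast ⊢
  split_ifs at hlast ⊢ with hnext
  · exact ⟨_, _, (Finset.mem_filter.1 (Finset.max'_mem _ hnext)).2.1, rfl⟩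
  · simp at hlast

theorem exists_dfsWord_eq (hn : 1 ≤ n) (hC : C.Connected) :
    ∃ u l, C.Adj 0 u ∧ dfsWord C = u :: l := by
  obtain ⟨u, l, hu, hl⟩ := exists_dfsSeq_eq hn hC
  obtain ⟨t, ht⟩ : [u, 0] <:+ (dfsSeq C).reverse.dedup := by
    have hdedup : ([u] ++ [0] : List (Fin (n + 1))).dedup = [u, 0] := by
      simp [List.dedup_cons_of_notMem, hu.ne']
    rw [hl, List.reverse_cons, List.reverse_cons, List.append_assoc, List.dedup_append, hdedup]
    exact List.suffix_union_right _ _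
  refine ⟨u, t.reverse.filter fun v => decide (v ≠ 0), hu, ?_⟩
  rw [dfsWord, ← ht]
  simp [hu.ne']

theorem nodup_dfsWord : (dfsWord C).Nodup :=
  (List.nodup_reverse.2 (List.nodup_dedup _)).filter _

theorem mem_dfsWord (hC : C.Connected) (v : Fin (n + 1)) : v ∈ dfsWord C ↔ v ≠ 0 := by
  simp [dfsWord, mem_dfsSeq hC v]

theorem length_dfsWord (hC : C.Connected) : (dfsWord C).length = n := by
  have hword : (dfsWord C).toFinset = Finset.univ.erase 0 := by
    ext v
    simp [mem_dfsWord hC]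
  rw [← List.toFinset_card_of_nodup nodup_dfsWord, hword]
  simp

theorem countP_adj_zero_dfsWord (hC : C.Connected) :
    (dfsWord C).countP (fun v => decide (C.Adj 0 v)) = C.degree 0 := by
  rw [List.countP_eq_length_filter, ← List.toFinset_card_of_nodup (nodup_dfsWord.filter _),
    ← SimpleGraph.card_neighborFinset_eq_degree]
  congr 1
  ext v
  simp only [List.mem_toFinset, List.mem_filter, mem_dfsWord hC, decide_eq_true_eq,
    SimpleGraph.mem_neighborFinset, and_iff_right_iff_imp]
  exact fun h => h.ne'

theorem length_splitBy_loop {α : Type*} (p : α → Bool) (l : List α) (a : α) (g : List α)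
    (gs : List (List α)) :
    (List.splitBy.loop (fun _ b => !p b) l a g gs).length = gs.length + 1 + l.countP p := by
  induction l generalizing a g gs with
  | nil => simp [List.splitBy.loop]
  | cons b l ih =>
    rw [List.splitBy.loop]
    cases hb : p b
    · simp [ih, hb]
    · simp only [Bool.not_true, ih, List.length_cons, List.countP_cons, hb, if_true]
      omega

theorem card_dfsParts (hn : 1 ≤ n) (hC : C.Connected) :
    (dfsParts C).card = C.degree 0 := by
  obtain ⟨u, l, hu, hl⟩ := exists_dfsWord_eq hn hC
  rw [← countP_adj_zero_dfsWord hC, dfsParts, Multiset.coe_card, List.length_map, dfsSubwords, hl,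
    List.splitBy, List.countP_cons_of_pos (by simpa using hu)]
  simp only [decide_not, length_splitBy_loop, List.length_nil]
  ring

theorem sum_dfsParts (hC : C.Connected) : (dfsParts C).sum = n := by
  rw [dfsParts, Multiset.sum_coe, ← List.length_flatten, dfsSubwords, List.flatten_splitBy,
    length_dfsWord hC]

theorem pos_of_mem_dfsParts {i : ℕ} (hi : i ∈ dfsParts C) : 0 < i := by
  rw [dfsParts, Multiset.mem_coe, List.mem_map] at hi
  obtain ⟨l, hl, rfl⟩ := hi
  exact List.length_pos_of_ne_nil (List.ne_nil_of_mem_splitBy hl)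

variable (C) in
/-- The partition `Λ(C)` of `n` attached to a connected graph `C` on `n + 1` vertices, its parts
being the multiset `dfsParts C`. -/
def dfsPartition (hC : C.Connected) : n.Partition where
  parts := dfsParts C
  parts_pos := pos_of_mem_dfsParts
  parts_sum := sum_dfsParts hC

end DepthFirstSearch

/-! ### Partitions determined by their number of parts -/

/-- The partition `lam` of `n` is the only one with its number of parts. This holds exactly for the
shapes of the theorem, and it makes the condition `Λ(C) = lam` one on the degree of the root. -/
def IsDeterminedByLength {n : ℕ} (lam : n.Partition) : Prop :=
  ∀ mu : n.Partition, mu.parts.card = lam.parts.card → mu = lam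

open Classical in
theorem IsDeterminedByLength.dfsGraphs_eq {n : ℕ} {lam : n.Partition}
    (hlam : IsDeterminedByLength lam) (hn : 1 ≤ n) :
    dfsGraphs lam = rootDegreeGraphs n lam.parts.card := by
  rw [dfsGraphs, Finset.filter_eq_self]
  intro C hC
  obtain ⟨hconn, hdeg⟩ := (Finset.mem_filter.1 hC).2
  exact congrArg Nat.Partition.parts
    (hlam (dfsPartition C hconn) ((card_dfsParts hn hconn).trans hdeg))

theorem isDeterminedByLength_of_parts_eq_singleton {n : ℕ} {lam : n.Partition}
    (h : lam.parts = {n}) : IsDeterminedByLength lam := by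
  intro mu hmu
  rw [h, Multiset.card_singleton, Multiset.card_eq_one] at hmu
  obtain ⟨a, ha⟩ := hmu
  have hsum := mu.parts_sum
  rw [ha, Multiset.sum_singleton] at hsum
  exact Nat.Partition.ext (by rw [ha, h, hsum])

theorem card_le_sum_of_pos {s : Multiset ℕ} (hs : ∀ i ∈ s, 0 < i) : s.card ≤ s.sum := by
  simpa using Multiset.card_nsmul_le_sum (s := s) (a := 1) hs

theorem eq_replicate_one_of_sum_eq_card {s : Multiset ℕ} (hs : ∀ i ∈ s, 0 < i)
    (h : s.sum = s.card) : s = Multiset.replicate s.card 1 := by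
  refine Multiset.eq_replicate.2 ⟨rfl, fun a ha => ?_⟩
  obtain ⟨t, rfl⟩ := Multiset.exists_cons_of_mem ha
  have hle := card_le_sum_of_pos fun i hi => hs i (Multiset.mem_cons_of_mem hi)
  have hpos := hs a ha
  simp only [Multiset.sum_cons, Multiset.card_cons] at h
  omega

theorem isDeterminedByLength_of_parts_eq_replicate {n : ℕ} {lam : n.Partition}
    (h : lam.parts = Multiset.replicate n 1) : IsDeterminedByLength lam := by
  intro mu hmu
  rw [h, Multiset.card_replicate] at hmu
  refine Nat.Partition.ext ?_
  rw [h, eq_replicate_one_of_sum_eq_card (fun _ => mu.parts_pos) (mu.parts_sum.trans hmu.symm), hmu]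

theorem eq_two_cons_replicate_of_sum_eq_card_add_one {s : Multiset ℕ} (hs : ∀ i ∈ s, 0 < i)
    (h : s.sum = s.card + 1) : s = 2 ::ₘ Multiset.replicate (s.card - 1) 1 := by
  obtain ⟨a, ha, ha2⟩ : ∃ a ∈ s, 2 ≤ a := by
    by_contra! hlt
    have hs1 : s = Multiset.replicate s.card 1 :=
      Multiset.eq_replicate.2
        ⟨rfl, fun a ha => Nat.le_antisymm (Nat.le_of_lt_succ (hlt a ha)) (hs a ha)⟩
    have hsum : s.sum = s.card := by simpa using congrArg Multiset.sum hs1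
    omega
  obtain ⟨t, rfl⟩ := Multiset.exists_cons_of_mem ha
  have ht : ∀ i ∈ t, 0 < i := fun i hi => hs i (Multiset.mem_cons_of_mem hi)
  have hle := card_le_sum_of_pos ht
  simp only [Multiset.sum_cons, Multiset.card_cons] at h
  obtain rfl : a = 2 := by omega
  rw [Multiset.card_cons, Nat.add_sub_cancel, ← eq_replicate_one_of_sum_eq_card ht (by omega)]

theorem two_le_of_parts_eq_cons {n : ℕ} {lam : n.Partition}
    (h : lam.parts = 2 ::ₘ Multiset.replicate (n - 2) 1) : 2 ≤ n :=
  Nat.Partition.le_of_mem_parts (h ▸ Multiset.mem_cons_self 2 _)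

theorem card_parts_of_parts_eq_cons {n : ℕ} {lam : n.Partition}
    (h : lam.parts = 2 ::ₘ Multiset.replicate (n - 2) 1) : lam.parts.card = n - 1 := by
  have hn := two_le_of_parts_eq_cons h
  rw [h, Multiset.card_cons, Multiset.card_replicate]
  omega

theorem isDeterminedByLength_of_parts_eq_cons {n : ℕ} {lam : n.Partition}
    (h : lam.parts = 2 ::ₘ Multiset.replicate (n - 2) 1) : IsDeterminedByLength lam := by
  intro mu hmu
  rw [card_parts_of_parts_eq_cons h] at hmu
  have hn := two_le_of_parts_eq_cons h
  have hsum : mu.parts.sum = mu.parts.card + 1 := by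
    rw [mu.parts_sum, hmu, Nat.sub_add_cancel (by omega)]
  refine Nat.Partition.ext ?_
  rw [h, eq_two_cons_replicate_of_sum_eq_card_add_one (fun _ => mu.parts_pos) hsum, hmu,
    Nat.sub_sub]

noncomputable section

/-! ### Edge enumerators of graphs on a finite set -/

section GraphEnum

variable {R : Type*} [CommSemiring R] {V W : Type*} [Fintype V] [Fintype W]

open Classical in
/-- The edge enumerator `∑ t ^ e(G)` of the graphs `G` on `V` with the property `p`. The variable
`t` is an element of any semiring, so that it can stand both for `t` and for `q - 1`. -/
def graphEnum (t : R) (p : SimpleGraph V → Prop) : R :=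
  ∑ G : SimpleGraph V with p G, t ^ G.edgeSet.ncard

theorem graphEnum_eq_sum [DecidableEq V] (t : R) (p : SimpleGraph V → Prop) [DecidablePred p] :
    graphEnum t p = ∑ G : SimpleGraph V with p G, t ^ G.edgeSet.ncard := by
  rw [graphEnum]
  congr!

theorem graphEnum_congr (t : R) (e : V ≃ W) {p : SimpleGraph V → Prop} {q : SimpleGraph W → Prop}
    (h : ∀ G : SimpleGraph W, p (G.comap e) ↔ q G) : graphEnum t p = graphEnum t q := by
  classical
  refine (Finset.sum_equiv e.symm.simpleGraph (fun G => ?_) fun G _ => ?_).symm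
  · simpa using (h G).symm
  · rw [← Nat.card_coe_set_eq, ← Nat.card_congr (SimpleGraph.Iso.comap e G).mapEdgeSet,
      Nat.card_coe_set_eq]
    rfl

theorem graphEnum_not {R : Type*} [CommRing R] (t : R) (p : SimpleGraph V → Prop) :
    (graphEnum t fun G => ¬p G) = graphEnum t (fun _ : SimpleGraph V => True) - graphEnum t p := by
  classical
  rw [eq_sub_iff_add_eq', graphEnum, graphEnum, graphEnum, Finset.filter_true,
    Finset.sum_filter_add_sum_filter_not]

/-- The edge enumerator of the connected graphs on `n` labelled vertices. -/
def connectedEnum (t : R) (n : ℕ) : R := graphEnum t (SimpleGraph.Connected (V := Fin n))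

open Classical in
/-- The enumerator of the connected graphs on `n` labelled vertices by their number of edges in
excess of a spanning tree. -/
def connectedExcessEnum (t : R) (n : ℕ) : R :=
  ∑ G : SimpleGraph (Fin n) with G.Connected, t ^ (G.edgeSet.ncard - (n - 1))

theorem graphEnum_connected (t : R) :
    graphEnum t (SimpleGraph.Connected (V := V)) = connectedEnum t (Fintype.card V) :=
  graphEnum_congr t (Fintype.equivFin V) fun G => (SimpleGraph.Iso.comap _ G).connected_iff

theorem connectedEnum_one (t : R) : connectedEnum t 1 = 1 := by
  classical
  rw [connectedEnum, graphEnum_eq_sum, Finset.filter_true_of_mem fun G _ => ⟨fun x y => by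
    rw [Subsingleton.elim x y]⟩, Fintype.sum_unique]
  simp

theorem connectedEnum_eq_pow_mul (t : R) (n : ℕ) :
    connectedEnum t n = t ^ (n - 1) * connectedExcessEnum t n := by
  classical
  rw [connectedEnum, graphEnum, connectedExcessEnum, Finset.mul_sum]
  refine Finset.sum_congr (by congr!) fun G hG => ?_
  have hle := (Finset.mem_filter.1 hG).2.card_vert_le_card_edgeSet_add_one
  rw [Nat.card_coe_set_eq, Nat.card_eq_fintype_card, Fintype.card_fin] at hle
  rw [← pow_add, Nat.add_sub_cancel' (by omega)]

theorem map_connectedExcessEnum {S : Type*} [CommSemiring S] (f : R →+* S) (t : R) (n : ℕ) :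
    f (connectedExcessEnum t n) = connectedExcessEnum (f t) n := by
  simp only [connectedExcessEnum, map_sum, map_pow]

end GraphEnum

/-! ### Adding a vertex -/

section AddVertex

variable {V : Type*}

/-- The graph obtained from `K` by adding a vertex `none` whose set of neighbours is `A`. -/
def addVertex (A : Finset V) (K : SimpleGraph V) : SimpleGraph (Option V) where
  Adj
    | none, none => False
    | none, some b => b ∈ A
    | some a, none => a ∈ A
    | some a, some b => K.Adj a b
  symm := ⟨by rintro (_ | a) (_ | b) <;> simp [K.adj_comm]⟩
  loopless := ⟨by rintro (_ | a) <;> simp⟩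

variable (A : Finset V) (K : SimpleGraph V)

@[simp]
theorem addVertex_adj_none_some (b : V) : (addVertex A K).Adj none (some b) ↔ b ∈ A := Iff.rfl

@[simp]
theorem addVertex_adj_some_none (a : V) : (addVertex A K).Adj (some a) none ↔ a ∈ A := Iff.rfl

@[simp]
theorem addVertex_adj_some_some (a b : V) :
    (addVertex A K).Adj (some a) (some b) ↔ K.Adj a b := Iff.rfl

/-- Every connected component of `K` contains a vertex of `A`: this is what makes `addVertex A K`
connected. -/
def EveryComponentMeets : Prop := ∀ x, ∃ a ∈ A, K.Reachable x a

theorem connected_addVertex_iff : (addVertex A K).Connected ↔ EveryComponentMeets A K := by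
  constructor
  · intro h x
    let s : Set (Option V) := {y | ∀ z, y = some z → ∃ a ∈ A, K.Reachable z a}
    suffices hs : ∀ y ∈ s, ∀ y', (addVertex A K).Adj y y' → y' ∈ s from
      mem_of_reachable_of_adj_closed hs (h.preconnected none (some x)) (by simp [s]) x rfl
    rintro (_ | y) hy _ hadj z rfl
    · exact ⟨z, hadj, .refl z⟩
    · obtain ⟨a, ha, hya⟩ := hy y rfl
      exact ⟨a, ha, SimpleGraph.Adj.reachable (G := K) hadj |>.symm.trans hya⟩
  · intro h
    rw [SimpleGraph.connected_iff_exists_forall_reachable]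
    refine ⟨none, Option.forall.2 ⟨.refl _, fun x => ?_⟩⟩
    obtain ⟨a, ha, hxa⟩ := h x
    let f : K →g addVertex A K := ⟨some, fun hab => hab⟩
    exact ((addVertex_adj_none_some A K a).2 ha).reachable.trans (hxa.map f).symm

theorem degree_none_addVertex [Fintype ((addVertex A K).neighborSet none)] :
    (addVertex A K).degree none = A.card := by
  have hnbrs : (addVertex A K).neighborFinset none = A.map .some := by ext (_ | x) <;> simp
  rw [← SimpleGraph.card_neighborFinset_eq_degree, hnbrs, Finset.card_map]

theorem ncard_edgeSet_addVertex [Finite V] :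
    (addVertex A K).edgeSet.ncard = A.card + K.edgeSet.ncard := by
  classical
  have := Fintype.ofFinite V
  have hpairs {U : Type _} [Fintype U] (G : SimpleGraph U) :
      2 * G.edgeSet.ncard = ∑ x, ∑ y, if G.Adj x y then 1 else 0 := by
    rw [← SimpleGraph.coe_edgeFinset, Set.ncard_coe_finset, SimpleGraph.two_mul_card_edgeFinset,
      Finset.card_filter, Fintype.sum_prod_type]
  have hG := hpairs (addVertex A K)
  have hA : (∑ x, if x ∈ A then 1 else 0) = A.card := by simp
  simp only [Fintype.sum_option, SimpleGraph.irrefl, if_false, addVertex_adj_none_some,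
    addVertex_adj_some_none, addVertex_adj_some_some, Finset.sum_add_distrib, ← hpairs K, hA] at hG
  omega

variable [Fintype V]

open Classical in
/-- A graph on `Option V` amounts to the neighbours of `none` and the graph induced on `V`. -/
def addVertexEquiv : Finset V × SimpleGraph V ≃ SimpleGraph (Option V) where
  toFun x := addVertex x.1 x.2
  invFun G := (Finset.univ.filter fun a => G.Adj none (some a), G.comap some)
  left_inv x := by ext <;> simp
  right_inv G := by ext (_ | x) (_ | y) <;> simp [G.adj_comm _ none]

variable {R : Type*} [CommSemiring R] (t : R)

theorem graphEnum_option (p : SimpleGraph (Option V) → Prop) :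
    graphEnum t p =
      ∑ A : Finset V, t ^ A.card * graphEnum t fun K => p (addVertex A K) := by
  classical
  simp_rw [graphEnum_eq_sum, Finset.mul_sum, ← pow_add, ← ncard_edgeSet_addVertex,
    Finset.sum_filter]
  rw [← addVertexEquiv.sum_comp, Fintype.sum_prod_type]
  rfl

variable (V) in
theorem graphEnum_true :
    graphEnum t (fun _ : SimpleGraph V => True) = (1 + t) ^ (Fintype.card V).choose 2 := by
  classical
  rw [graphEnum_congr t (Fintype.equivFin V) (q := fun _ => True) fun _ => Iff.rfl]
  induction Fintype.card V with
  | zero => simp [graphEnum_eq_sum]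
  | succ m ih =>
    rw [graphEnum_congr t (finSuccEquiv m) (q := fun _ => True) fun _ => Iff.rfl, graphEnum_option]
    have hsubsets : ∑ A : Finset (Fin m), t ^ A.card = (1 + t) ^ m := by
      simpa [add_comm] using Fintype.sum_pow_mul_eq_add_pow (Fin m) t 1
    rw [← Finset.sum_mul, ih, hsubsets, ← pow_add,
      Nat.choose_succ_succ' m 1, Nat.choose_one_right]

end AddVertex

/-! ### Splitting off the component of a vertex -/

section Component

variable {V W : Type*}

open scoped SimpleGraph
open Finset.HasAntidiagonal (antidiagonal)

theorem reachable_sum_inl_iff {H : SimpleGraph V} {K : SimpleGraph W} {v w : V} :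
    (H ⊕g K).Reachable (.inl v) (.inl w) ↔ H.Reachable v w := by
  refine ⟨fun h => ?_, fun h => h.map SimpleGraph.Embedding.sumInl.toHom⟩
  suffices hs : ∀ x ∈ Sum.inl '' {u | H.Reachable v u}, ∀ y, (H ⊕g K).Adj x y →
      y ∈ Sum.inl '' {u | H.Reachable v u} by
    simpa using mem_of_reachable_of_adj_closed hs h (by simp)
  rintro _ ⟨u, hu, rfl⟩ (u' | w) hadj
  · exact ⟨u', hu.trans (SimpleGraph.sum_adj_inl.1 hadj).reachable, rfl⟩
  · exact absurd hadj (SimpleGraph.not_adj_sum_inl_inr u w)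

theorem forall_reachable_sum_inl_iff {H : SimpleGraph V} {K : SimpleGraph W} {v : V} :
    (∀ x, (H ⊕g K).Reachable (.inl v) x ↔ x.isLeft) ↔ H.Connected := by
  simp only [Sum.forall, reachable_sum_inl_iff, Sum.isLeft_inl, iff_true, Sum.isLeft_inr,
    SimpleGraph.not_reachable_sum_inl_inr, Bool.false_eq_true, implies_true, and_true]
  rw [SimpleGraph.connected_iff_exists_forall_reachable]
  exact ⟨fun h => ⟨v, h⟩, fun ⟨u, hu⟩ x => (hu v).symm.trans (hu x)⟩

theorem comap_inl_sum_comap_inr {G : SimpleGraph (V ⊕ W)} {v : V}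
    (h : ∀ x, G.Reachable (.inl v) x ↔ x.isLeft) : G.comap .inl ⊕g G.comap .inr = G := by
  have hlr (a : V) (b : W) : ¬G.Adj (.inl a) (.inr b) := fun hadj => by
    simpa using (h (.inr b)).1 (((h (.inl a)).2 rfl).trans hadj.reachable)
  ext (a | a) (b | b)
  · simp
  · simp [hlr]
  · simp [hlr, G.adj_comm (.inr a)]
  · simp

variable {R : Type*} [CommSemiring R] (t : R) [Fintype V]

theorem graphEnum_component_inl [Fintype W] (v : V) :
    (graphEnum t fun G : SimpleGraph (V ⊕ W) => ∀ x, G.Reachable (.inl v) x ↔ x.isLeft) =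
      connectedEnum t (Fintype.card V) * (1 + t) ^ (Fintype.card W).choose 2 := by
  classical
  rw [← graphEnum_connected, ← graphEnum_true]
  simp only [graphEnum_eq_sum, Finset.filter_true]
  rw [Finset.sum_mul_sum, ← Finset.sum_product']
  refine Finset.sum_nbij' (fun G => (G.comap .inl, G.comap .inr)) (fun x => x.1 ⊕g x.2)
    (fun G hG => ?_) (fun x hx => ?_) (fun G hG => ?_) (fun x _ => ?_) fun G hG => ?_
  all_goals simp only [Finset.mem_product, Finset.mem_filter_univ, Finset.mem_univ,
    and_true] at *
  · rwa [← comap_inl_sum_comap_inr hG, forall_reachable_sum_inl_iff] at hG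
  · exact forall_reachable_sum_inl_iff.2 hx
  · exact comap_inl_sum_comap_inr hG
  · ext <;> simp
  · have hedges := Nat.card_congr
      (SimpleGraph.edgeSetSumEquiv (G := G.comap Sum.inl) (H := G.comap Sum.inr))
    rw [comap_inl_sum_comap_inr hG, Nat.card_sum] at hedges
    simp only [Nat.card_coe_set_eq] at hedges
    rw [hedges, pow_add]

theorem graphEnum_component [DecidableEq V] {v : V} {s : Finset V} (hv : v ∈ s) :
    (graphEnum t fun G => ∀ x, G.Reachable v x ↔ x ∈ s) =
      connectedEnum t s.card * (1 + t) ^ sᶜ.card.choose 2 := by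
  rw [← graphEnum_congr t (Equiv.sumCompl (· ∈ s)), graphEnum_component_inl t ⟨v, hv⟩]
  · simp [Finset.card_compl, Fintype.card_subtype_compl]
  · intro G
    refine Equiv.forall_congr (Equiv.sumCompl (· ∈ s)) fun y => ?_
    rw [← (SimpleGraph.Iso.comap (Equiv.sumCompl (· ∈ s)) G).reachable_iff]
    rcases y with y | y <;> simp [y.2]

theorem one_add_pow_choose_two_eq_sum (m : ℕ) :
    (1 + t) ^ (m + 1).choose 2 = ∑ ij ∈ antidiagonal m,
      m.choose ij.1 • (connectedEnum t (ij.1 + 1) * (1 + t) ^ ij.2.choose 2) := by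
  classical
  let comp (G : SimpleGraph (Option (Fin m))) : Finset (Fin m) :=
    Finset.univ.filter fun x => G.Reachable none (some x)
  have hcomp (G) (A : Finset (Fin m)) :
      comp G = A ↔ ∀ x, G.Reachable none x ↔ x ∈ A.insertNone := by
    simp [comp, Finset.ext_iff, Option.forall]
  have htotal := graphEnum_true (Option (Fin m)) t
  rw [Fintype.card_option, Fintype.card_fin] at htotal
  rw [← htotal, graphEnum_eq_sum, Finset.filter_true, ← Finset.sum_fiberwise Finset.univ comp,
    Finset.Nat.sum_antidiagonal_eq_sum_range_succ_mk]
  simp only [hcomp, ← graphEnum_eq_sum, graphEnum_component t Finset.none_mem_insertNone,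
    Finset.card_compl, Finset.card_insertNone, Fintype.card_option, Fintype.card_fin,
    Nat.add_sub_add_right]
  simpa using Finset.sum_powerset_apply_card
    (fun j => connectedEnum t (j + 1) * (1 + t) ^ (m - j).choose 2) (x := Finset.univ (α := Fin m))

end Component

/-! ### Connected graphs whose root has a given degree -/

section RootDegree

variable {R : Type*} {V : Type*} [Fintype V]

theorem graphEnum_everyComponentMeets_singleton [CommSemiring R] (t : R) (a : V) :
    graphEnum t (EveryComponentMeets {a}) = connectedEnum t (Fintype.card V) := by
  rw [← graphEnum_connected]
  refine congrArg (graphEnum t) (funext fun K => propext ?_)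
  simp only [EveryComponentMeets, Finset.mem_singleton, exists_eq_left,
    SimpleGraph.connected_iff_exists_forall_reachable]
  exact ⟨fun h => ⟨a, fun x => (h x).symm⟩, fun ⟨b, hb⟩ x => (hb x).symm.trans (hb a)⟩

variable (V) in
theorem graphEnum_everyComponentMeets_univ [CommSemiring R] (t : R) :
    graphEnum t (EveryComponentMeets (Finset.univ (α := V))) =
      (1 + t) ^ (Fintype.card V).choose 2 := by
  rw [← graphEnum_true]
  exact congrArg (graphEnum t) (funext fun K => eq_true fun x => ⟨x, Finset.mem_univ x, .refl x⟩)

theorem everyComponentMeets_compl_singleton_iff [DecidableEq V] {K : SimpleGraph V} {b : V} :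
    EveryComponentMeets {b}ᶜ K ↔ ¬∀ x, K.Reachable b x ↔ x ∈ ({b} : Finset V) := by
  simp only [EveryComponentMeets, Finset.mem_compl, Finset.mem_singleton]
  constructor
  · intro h hb
    obtain ⟨a, ha, hba⟩ := h b
    exact ha ((hb a).1 hba)
  · intro h x
    by_cases hx : x = b
    · subst hx
      by_contra! hcon
      refine h fun a => ⟨fun ha => by_contra fun hne => hcon a hne ha, ?_⟩
      rintro rfl
      exact .refl a
    · exact ⟨x, hx, .refl x⟩

theorem graphEnum_everyComponentMeets_compl_singleton [DecidableEq V] [CommRing R] (t : R)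
    (b : V) :
    graphEnum t (EveryComponentMeets {b}ᶜ) =
      (1 + t) ^ (Fintype.card V).choose 2 - (1 + t) ^ (Fintype.card V - 1).choose 2 := by
  rw [show EveryComponentMeets {b}ᶜ = _ from
    funext fun K => propext everyComponentMeets_compl_singleton_iff, graphEnum_not, graphEnum_true,
    graphEnum_component t (Finset.mem_singleton_self b), Finset.card_compl, Finset.card_singleton,
    connectedEnum_one, one_mul]

open Classical in
theorem edgeEnumerator_rootDegreeGraphs (n s : ℕ) :
    edgeEnumerator (rootDegreeGraphs n s) =
      ∑ A ∈ Finset.powersetCard s (Finset.univ (α := Fin n)),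
        X ^ s * graphEnum X (EveryComponentMeets A) := by
  have hgraphs : edgeEnumerator (rootDegreeGraphs n s) = graphEnum X
      fun G : SimpleGraph (Option (Fin n)) => G.Connected ∧ G.degree none = s := by
    rw [edgeEnumerator, rootDegreeGraphs, ← graphEnum_congr X (finSuccEquiv n)
      (p := fun C => C.Connected ∧ C.degree 0 = s), graphEnum_eq_sum]
    · simp only [← SimpleGraph.coe_edgeFinset, Set.ncard_coe_finset]
    · intro G
      have hdegree := (SimpleGraph.Iso.comap (finSuccEquiv n) G).degree_eq 0
      rw [SimpleGraph.Iso.comap_apply, finSuccEquiv_zero] at hdegree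
      rw [(SimpleGraph.Iso.comap (finSuccEquiv n) G).connected_iff]
      convert Iff.rfl using 3
      convert hdegree
  have hpowerset : Finset.powersetCard s (Finset.univ (α := Fin n)) =
      Finset.univ.filter fun A => A.card = s := by
    ext A
    simp
  rw [hgraphs, graphEnum_option, hpowerset, Finset.sum_filter]
  refine Finset.sum_congr rfl fun A _ => ?_
  simp only [connected_addVertex_iff, degree_none_addVertex]
  split_ifs with hA
  · simp only [hA, and_true]
  · simp [hA, graphEnum]

theorem edgeEnumerator_rootDegreeGraphs_eq_choose_mul {n s : ℕ} {c : ℚ[X]}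
    (hc : ∀ A : Finset (Fin n), A.card = s → graphEnum X (EveryComponentMeets A) = c) :
    edgeEnumerator (rootDegreeGraphs n s) = (n.choose s : ℚ[X]) * (X ^ s * c) := by
  rw [edgeEnumerator_rootDegreeGraphs, Finset.sum_eq_card_nsmul (b := X ^ s * c) fun A hA => by
    rw [hc A (Finset.mem_powersetCard.1 hA).2]]
  simp

theorem edgeEnumerator_rootDegreeGraphs_one (n : ℕ) :
    edgeEnumerator (rootDegreeGraphs n 1) = (n : ℚ[X]) * (X * connectedEnum X n) := by
  rw [edgeEnumerator_rootDegreeGraphs_eq_choose_mul (c := connectedEnum X n), Nat.choose_one_right,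
    pow_one]
  intro A hA
  obtain ⟨a, rfl⟩ := Finset.card_eq_one.1 hA
  rw [graphEnum_everyComponentMeets_singleton, Fintype.card_fin]

theorem edgeEnumerator_rootDegreeGraphs_self (n : ℕ) :
    edgeEnumerator (rootDegreeGraphs n n) = X ^ n * (1 + X) ^ n.choose 2 := by
  rw [edgeEnumerator_rootDegreeGraphs_eq_choose_mul (c := (1 + X) ^ n.choose 2), Nat.choose_self,
    Nat.cast_one, one_mul]
  intro A hA
  rw [Finset.eq_univ_of_card A (hA.trans (Fintype.card_fin n).symm),
    graphEnum_everyComponentMeets_univ, Fintype.card_fin]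

theorem edgeEnumerator_rootDegreeGraphs_succ_self (m : ℕ) :
    edgeEnumerator (rootDegreeGraphs (m + 1) m) =
      ((m + 1 : ℕ) : ℚ[X]) * (X ^ m * ((1 + X) ^ (m + 1).choose 2 - (1 + X) ^ m.choose 2)) := by
  rw [edgeEnumerator_rootDegreeGraphs_eq_choose_mul
    (c := (1 + X) ^ (m + 1).choose 2 - (1 + X) ^ m.choose 2), Nat.choose_succ_self_right]
  intro A hA
  obtain ⟨b, hb⟩ : ∃ b, Aᶜ = {b} := by
    rw [← Finset.card_eq_one, Finset.card_compl, hA, Fintype.card_fin, Nat.add_sub_cancel_left]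
  rw [← compl_compl A, hb, graphEnum_everyComponentMeets_compl_singleton, Fintype.card_fin,
    Nat.add_sub_cancel]

end RootDegree

/-! ### Monomial symmetric polynomials -/

theorem exists_mem_toFinset_eq_cons_val {α : Type*} [DecidableEq α] {s : Multiset α}
    (hs : s.card = s.toFinset.card + 1) : ∃ a ∈ s.toFinset, s = a ::ₘ s.toFinset.val := by
  obtain ⟨t, ht⟩ := Multiset.le_iff_exists_add.1 (Multiset.dedup_le s)
  rw [← Multiset.toFinset_val] at ht
  obtain ⟨a, rfl⟩ : ∃ a, t = {a} := by
    rw [← Multiset.card_eq_one]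
    have hcard := congrArg Multiset.card ht
    rw [Multiset.card_add, Finset.card_val] at hcard
    omega
  refine ⟨a, ?_, by rwa [add_comm, Multiset.singleton_add] at ht⟩
  rw [Multiset.mem_toFinset, ht]
  exact Multiset.mem_add.2 (Or.inr (Multiset.mem_singleton_self a))

section Symmetric

open MvPolynomial (esymm psum msymm)
open Finset.HasAntidiagonal (antidiagonal)

variable (σ R : Type*) [Fintype σ]

section CommSemiring

variable [CommSemiring R] [DecidableEq σ]

theorem IsDeterminedByLength.msymm_eq {n : ℕ} {lam : n.Partition}
    (hlam : IsDeterminedByLength lam) :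
    msymm σ R lam = ∑ s : Sym σ n with (Sym.toMultiset s).toFinset.card = lam.parts.card,
      ((s : Multiset σ).map MvPolynomial.X).prod := by
  have hofSym (s : Sym σ n) :
      (s : Multiset σ).toFinset.card = lam.parts.card ↔ Nat.Partition.ofSym s = lam := by
    have hcard : (Nat.Partition.ofSym s).parts.card = (s : Multiset σ).toFinset.card := by
      simp [Nat.Partition.ofSym, Multiset.toFinset]
    rw [← hcard]
    exact ⟨hlam _, fun h => h ▸ rfl⟩
  exact (Finset.sum_subtype _ (fun s => (Finset.mem_filter_univ s).trans (hofSym s))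
    fun s : Sym σ n => ((s : Multiset σ).map MvPolynomial.X).prod).symm

theorem msymm_eq_psum {n : ℕ} (hn : n ≠ 0) {lam : n.Partition} (hlam : lam.parts = {n}) :
    msymm σ R lam = psum σ R n := by
  rw [(isDeterminedByLength_of_parts_eq_singleton hlam).msymm_eq σ R, psum, hlam,
    Multiset.card_singleton]
  refine (Finset.sum_nbij (fun i => Sym.replicate n i) ?_ ?_ ?_ ?_).symm
  · intro i _
    rw [Finset.mem_filter_univ, Sym.coe_replicate, Multiset.toFinset_replicate, if_neg hn,
      Finset.card_singleton]
  · exact fun i _ j _ h => (Sym.replicate_right_inj hn).1 h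
  · intro s hs
    obtain ⟨i, hi⟩ := Finset.card_eq_one.1 ((Finset.mem_filter_univ s).1 hs)
    refine ⟨i, Finset.mem_coe.2 (Finset.mem_univ i), (Sym.eq_replicate.2 fun b hb => ?_).symm⟩
    rwa [← Sym.mem_coe, ← Multiset.mem_toFinset, hi, Finset.mem_singleton] at hb
  · intro i _
    rw [Sym.coe_replicate, Multiset.map_replicate, Multiset.prod_replicate]

theorem msymm_eq_esymm {n : ℕ} {lam : n.Partition} (hlam : lam.parts = Multiset.replicate n 1) :
    msymm σ R lam = esymm σ R n := by
  rw [(isDeterminedByLength_of_parts_eq_replicate hlam).msymm_eq σ R, esymm, hlam,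
    Multiset.card_replicate]
  refine (Finset.sum_bij (fun S hS => Sym.mk S.val ?_) ?_ ?_ ?_ ?_).symm
  · rw [Finset.card_val, Finset.mem_powersetCard_univ.1 hS]
  · intro S hS
    rw [Finset.mem_filter_univ, Sym.coe_mk, Finset.val_toFinset]
    exact Finset.mem_powersetCard_univ.1 hS
  · exact fun S _ T _ h => Finset.val_injective (congrArg Sym.toMultiset h)
  · intro s hs
    rw [Finset.mem_filter_univ] at hs
    refine ⟨(s : Multiset σ).toFinset, Finset.mem_powersetCard_univ.2 hs, Sym.coe_injective ?_⟩
    rw [Sym.coe_mk, Multiset.toFinset_val, Multiset.dedup_eq_self,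
      ← Multiset.toFinset_card_eq_card_iff_nodup, hs, Sym.card_coe]
  · exact fun S _ => rfl

theorem msymm_eq_sum_sum_mul_prod {n : ℕ} {lam : (n + 1).Partition}
    (hlam : lam.parts = 2 ::ₘ Multiset.replicate (n + 1 - 2) 1) :
    msymm σ R lam = ∑ S ∈ Finset.powersetCard n (Finset.univ (α := σ)),
      ∑ a ∈ S, MvPolynomial.X a * ∏ i ∈ S, MvPolynomial.X i := by
  rw [(isDeterminedByLength_of_parts_eq_cons hlam).msymm_eq σ R, card_parts_of_parts_eq_cons hlam,
    Nat.add_sub_cancel, Finset.sum_sigma']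
  have htoFinset {S : Finset σ} {a : σ} (ha : a ∈ S) : (a ::ₘ S.val).toFinset = S := by
    rw [Multiset.toFinset_cons, Finset.val_toFinset, Finset.insert_eq_self.2 ha]
  refine (Finset.sum_bij (fun x hx => Sym.mk (x.2 ::ₘ x.1.val) ?_) ?_ ?_ ?_ ?_).symm
  · rw [Multiset.card_cons, Finset.card_val,
      Finset.mem_powersetCard_univ.1 (Finset.mem_sigma.1 hx).1]
  · rintro ⟨S, a⟩ hx
    rw [Finset.mem_sigma, Finset.mem_powersetCard_univ] at hx
    rw [Finset.mem_filter_univ, Sym.coe_mk, htoFinset hx.2, hx.1]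
  · rintro ⟨S, a⟩ hx ⟨T, b⟩ hy h
    replace h : a ::ₘ S.val = b ::ₘ T.val := congrArg Sym.toMultiset h
    obtain rfl : S = T := by
      have hST := congrArg Multiset.toFinset h
      rwa [htoFinset (Finset.mem_sigma.1 hx).2, htoFinset (Finset.mem_sigma.1 hy).2] at hST
    rw [(Multiset.cons_inj_left _).1 h]
  · intro s hs
    rw [Finset.mem_filter_univ] at hs
    obtain ⟨a, ha, hsa⟩ := exists_mem_toFinset_eq_cons_val (s := s.toMultiset)
      (by rw [Sym.card_coe, hs])
    exact ⟨⟨_, a⟩, Finset.mem_sigma.2 ⟨Finset.mem_powersetCard_univ.2 hs, ha⟩,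
      Sym.coe_injective hsa.symm⟩
  · rintro ⟨S, a⟩ _
    rw [Sym.coe_mk, Multiset.map_cons, Multiset.prod_cons]
    rfl

theorem succ_nsmul_esymm_succ (n : ℕ) :
    (n + 1) • esymm σ R (n + 1) = ∑ S ∈ Finset.powersetCard n (Finset.univ (α := σ)),
      ∑ a ∈ Sᶜ, MvPolynomial.X a * ∏ i ∈ S, MvPolynomial.X i := by
  have hcount : (n + 1) • esymm σ R (n + 1) =
      ∑ T ∈ Finset.powersetCard (n + 1) (Finset.univ (α := σ)),
        ∑ _a ∈ T, ∏ i ∈ T, MvPolynomial.X i := by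
    rw [esymm, Finset.smul_sum]
    refine Finset.sum_congr rfl fun T hT => ?_
    rw [Finset.sum_const, Finset.mem_powersetCard_univ.1 hT]
  rw [hcount, Finset.sum_sigma', Finset.sum_sigma']
  refine Finset.sum_bij' (fun x _ => ⟨x.1.erase x.2, x.2⟩) (fun x _ => ⟨insert x.2 x.1, x.2⟩)
    ?_ ?_ ?_ ?_ ?_
  all_goals
    rintro ⟨S, a⟩ hx
    simp only [Finset.mem_sigma, Finset.mem_powersetCard_univ, Finset.mem_compl] at hx ⊢
  · rw [Finset.card_erase_of_mem hx.2, hx.1]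
    exact ⟨rfl, Finset.notMem_erase a S⟩
  · rw [Finset.card_insert_of_notMem hx.2, hx.1]
    exact ⟨rfl, Finset.mem_insert_self a S⟩
  · rw [Finset.insert_erase hx.2]
  · rw [Finset.erase_insert hx.2]
  · rw [Finset.mul_prod_erase S _ hx.2]

theorem psum_one_mul_esymm {n : ℕ} {lam : (n + 1).Partition}
    (hlam : lam.parts = 2 ::ₘ Multiset.replicate (n + 1 - 2) 1) :
    psum σ R 1 * esymm σ R n = (n + 1) • esymm σ R (n + 1) + msymm σ R lam := by
  rw [succ_nsmul_esymm_succ, msymm_eq_sum_sum_mul_prod σ R hlam, ← Finset.sum_add_distrib,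
    MvPolynomial.psum_one, esymm, Finset.mul_sum]
  refine Finset.sum_congr rfl fun S _ => ?_
  rw [Finset.sum_compl_add_sum, Finset.sum_mul]

end CommSemiring

theorem succ_nsmul_esymm_succ_eq_sum_psum [CommRing R] (m : ℕ) :
    (m + 1) • esymm σ R (m + 1) =
      ∑ ij ∈ antidiagonal m, (-1) ^ ij.1 * psum σ R (ij.1 + 1) * esymm σ R ij.2 := by
  rw [nsmul_eq_mul, MvPolynomial.mul_esymm_eq_sum, Finset.sum_filter,
    Finset.Nat.sum_antidiagonal_succ', if_neg (lt_irrefl _), zero_add, Finset.mul_sum,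
    ← Finset.Nat.sum_antidiagonal_swap]
  refine Finset.sum_congr rfl fun ⟨i, j⟩ hij => ?_
  obtain rfl := Finset.HasAntidiagonal.mem_antidiagonal.1 hij
  have hsign : (-1 : MvPolynomial σ R) ^ (i + j + 1 + 1) * (-1) ^ j = (-1) ^ i := by
    rw [← pow_add, show i + j + 1 + 1 + j = i + 2 * (j + 1) by ring, pow_add, pow_mul, neg_one_sq,
      one_pow, mul_one]
  rw [Prod.swap_prod_mk, if_pos (by dsimp only; omega)]
  linear_combination esymm σ R j * psum σ R (i + 1) * hsign

end Symmetric

/-! ### The specialization of elementary and power sum symmetric polynomials -/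

section Specialization

open MvPolynomial (symmetricSubalgebra)
open Finset.HasAntidiagonal (antidiagonal)

/-- The elementary symmetric polynomial `e_k` in `n` variables as an element of the algebra on which
`specialization` is defined. -/
def symmetricEsymm (n k : ℕ) : symmetricSubalgebra (Fin n) ℚ :=
  ⟨MvPolynomial.esymm (Fin n) ℚ k, MvPolynomial.esymm_isSymmetric _ _ k⟩

/-- The power sum `p_k` in `n` variables as an element of the algebra on which `specialization` is
defined. -/
def symmetricPsum (n k : ℕ) : symmetricSubalgebra (Fin n) ℚ :=
  ⟨MvPolynomial.psum (Fin n) ℚ k, MvPolynomial.psum_isSymmetric _ _ k⟩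

theorem specialization_symmetricEsymm {n k : ℕ} (hk : k ≤ n) :
    specialization n (symmetricEsymm n k) = C (1 / (k.factorial : ℚ)) * X ^ k.choose 2 := by
  rcases k with _ | k
  · have h0 : symmetricEsymm n 0 = 1 := Subtype.ext (MvPolynomial.esymm_zero (Fin n) ℚ)
    simp [h0]
  · have h := MvPolynomial.esymmAlgEquiv_symm_apply (σ := Fin n) (R := ℚ) (Fintype.card_fin n)
      ⟨k, hk⟩
    exact (congrArg (MvPolynomial.aeval _) h).trans (MvPolynomial.aeval_X _ _)

theorem eq_of_sum_antidiagonal_mul_eq {R : Type*} [Ring R] {a b c : ℕ → R} (ha : a 0 = 1) {n : ℕ}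
    (h : ∀ m < n, ∑ ij ∈ antidiagonal m, b ij.1 * a ij.2 = ∑ ij ∈ antidiagonal m, c ij.1 * a ij.2)
    {m : ℕ} (hm : m < n) : b m = c m := by
  induction m using Nat.strong_induction_on with
  | _ m ih =>
    have hmem : (m, 0) ∈ antidiagonal m := Finset.HasAntidiagonal.mem_antidiagonal.2 (add_zero m)
    have hsum := h m hm
    rw [← Finset.add_sum_erase _ _ hmem, ← Finset.add_sum_erase _ _ hmem, ha, mul_one,
      mul_one] at hsum
    refine add_right_cancel (hsum.trans (congrArg (c m + ·) (Finset.sum_congr rfl ?_).symm))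
    rintro ⟨i, j⟩ hij
    rw [Finset.mem_erase, Finset.HasAntidiagonal.mem_antidiagonal, Ne, Prod.mk.injEq] at hij
    rw [ih i (by grind) (by grind)]

theorem inv_factorial_mul_choose {i j : ℕ} :
    C (1 / ((i + j).factorial : ℚ)) * ((i + j).choose i : ℚ[X]) =
      C (1 / (i.factorial : ℚ)) * C (1 / (j.factorial : ℚ)) := by
  rw [← C_eq_natCast, ← C_mul, ← C_mul, Nat.cast_add_choose]
  congr 1
  field_simp

theorem succ_mul_inv_factorial_succ (m : ℕ) :
    ((m + 1 : ℕ) : ℚ[X]) * C (1 / ((m + 1).factorial : ℚ)) = C (1 / (m.factorial : ℚ)) := by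
  rw [← C_eq_natCast, ← C_mul, Nat.factorial_succ]
  congr 1
  push_cast
  field_simp

theorem specialization_newton {n m : ℕ} (hm : m < n) :
    C (1 / (m.factorial : ℚ)) * X ^ (m + 1).choose 2 =
      ∑ ij ∈ antidiagonal m, (-1) ^ ij.1 * specialization n (symmetricPsum n (ij.1 + 1)) *
        (C (1 / (ij.2.factorial : ℚ)) * X ^ ij.2.choose 2) := by
  have hnewton : (m + 1) • symmetricEsymm n (m + 1) = ∑ ij ∈ antidiagonal m,
      (-1) ^ ij.1 * symmetricPsum n (ij.1 + 1) * symmetricEsymm n ij.2 :=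
    Subtype.ext (by
      simpa [symmetricEsymm, symmetricPsum] using succ_nsmul_esymm_succ_eq_sum_psum (Fin n) ℚ m)
  have hspec := congrArg (specialization n) hnewton
  rw [map_nsmul, specialization_symmetricEsymm hm, nsmul_eq_mul, ← mul_assoc,
    succ_mul_inv_factorial_succ, map_sum] at hspec
  rw [hspec]
  refine Finset.sum_congr rfl fun ij hij => ?_
  rw [map_mul, map_mul, map_pow, map_neg, map_one, specialization_symmetricEsymm
    ((Finset.HasAntidiagonal.antidiagonal.snd_le hij).trans hm.le)]

theorem inv_factorial_mul_X_pow_choose_two (m : ℕ) :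
    C (1 / (m.factorial : ℚ)) * (X : ℚ[X]) ^ (m + 1).choose 2 =
      ∑ ij ∈ antidiagonal m, C (1 / (ij.1.factorial : ℚ)) * connectedEnum (X - 1) (ij.1 + 1) *
        (C (1 / (ij.2.factorial : ℚ)) * X ^ ij.2.choose 2) := by
  have hX := one_add_pow_choose_two_eq_sum (X - 1 : ℚ[X]) m
  rw [add_sub_cancel] at hX
  rw [hX, Finset.mul_sum]
  refine Finset.sum_congr rfl fun ⟨i, j⟩ hij => ?_
  obtain rfl := Finset.HasAntidiagonal.mem_antidiagonal.1 hij
  rw [nsmul_eq_mul, ← mul_assoc, inv_factorial_mul_choose, mul_mul_mul_comm]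

theorem specialization_symmetricPsum {n m : ℕ} (hm : m < n) :
    specialization n (symmetricPsum n (m + 1)) =
      (-1) ^ m * (C (1 / (m.factorial : ℚ)) * connectedEnum (X - 1) (m + 1)) := by
  have hsigned : (-1) ^ m * specialization n (symmetricPsum n (m + 1)) =
      C (1 / (m.factorial : ℚ)) * connectedEnum (X - 1) (m + 1) :=
    eq_of_sum_antidiagonal_mul_eq
      (a := fun j => C (1 / (j.factorial : ℚ)) * X ^ j.choose 2)
      (b := fun i => (-1) ^ i * specialization n (symmetricPsum n (i + 1)))
      (c := fun i => C (1 / (i.factorial : ℚ)) * connectedEnum (X - 1) (i + 1))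
      (by simp)
      (fun k hk => (specialization_newton hk).symm.trans (inv_factorial_mul_X_pow_choose_two k)) hm
  rw [← hsigned, ← mul_assoc, ← mul_pow, neg_one_mul, neg_neg, one_pow, one_mul]

theorem specializedMonomial_of_parts_eq_singleton {m : ℕ} {lam : (m + 1).Partition}
    (hlam : lam.parts = {m + 1}) :
    specializedMonomial lam =
      (-1) ^ m * (C (1 / (m.factorial : ℚ)) * connectedEnum (X - 1) (m + 1)) := by
  rw [← specialization_symmetricPsum (Nat.lt_succ_self m), specializedMonomial]
  exact congrArg _ (Subtype.ext (msymm_eq_psum (Fin (m + 1)) ℚ m.succ_ne_zero hlam))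

theorem specializedMonomial_of_parts_eq_replicate {n : ℕ} {lam : n.Partition}
    (hlam : lam.parts = Multiset.replicate n 1) :
    specializedMonomial lam = C (1 / (n.factorial : ℚ)) * X ^ n.choose 2 := by
  rw [← specialization_symmetricEsymm le_rfl, specializedMonomial]
  exact congrArg _ (Subtype.ext (msymm_eq_esymm (Fin n) ℚ hlam))

theorem specializedMonomial_of_parts_eq_cons {m : ℕ} {lam : (m + 1).Partition}
    (hlam : lam.parts = 2 ::ₘ Multiset.replicate (m + 1 - 2) 1) :
    specializedMonomial lam = C (1 / (m.factorial : ℚ)) * X ^ m.choose 2 * (1 - X ^ m) := by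
  have hpieri : symmetricEsymm (m + 1) 1 * symmetricEsymm (m + 1) m =
      (m + 1) • symmetricEsymm (m + 1) (m + 1) +
        ⟨MvPolynomial.msymm (Fin (m + 1)) ℚ lam, MvPolynomial.msymm_isSymmetric _ _ lam⟩ :=
    Subtype.ext (by
      simpa [symmetricEsymm, MvPolynomial.esymm_one, MvPolynomial.psum_one] using
        psum_one_mul_esymm (Fin (m + 1)) ℚ hlam)
  have hspec := congrArg (specialization (m + 1)) hpieri
  rw [map_mul, map_add, map_nsmul, specialization_symmetricEsymm (Nat.le_add_left 1 m),
    specialization_symmetricEsymm (Nat.le_succ m), specialization_symmetricEsymm le_rfl,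
    nsmul_eq_mul, ← mul_assoc ((m + 1 : ℕ) : ℚ[X]), succ_mul_inv_factorial_succ,
    Nat.choose_succ_succ' m 1, Nat.choose_one_right, pow_add] at hspec
  rw [specializedMonomial, eq_sub_of_add_eq' hspec.symm]
  simp only [Nat.factorial_one, Nat.cast_one, div_one, C_1, Nat.choose_eq_zero_of_lt one_lt_two,
    pow_zero]
  ring

end Specialization

/-! ### The numerical invariants of the three shapes -/

theorem sum_mapIdx_replicate_one (k c : ℕ) :
    ((List.replicate k 1).mapIdx fun i a => (i + c) * a).sum = k.choose 2 + k * c := by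
  induction k generalizing c with
  | zero => simp
  | succ k ih =>
    rw [List.replicate_succ, List.mapIdx_cons, List.sum_cons]
    simp_rw [add_assoc, ih]
    rw [Nat.choose_succ_succ' k 1, Nat.choose_one_right]
    ring

theorem sort_replicate_one (k : ℕ) :
    (Multiset.replicate k 1).sort (· ≥ ·) = List.replicate k 1 :=
  List.eq_replicate_iff.2
    ⟨by simp, fun _ hb => Multiset.eq_of_mem_replicate ((Multiset.mem_sort _).1 hb)⟩

section Invariants

variable {n k : ℕ} {lam : n.Partition}

theorem partitionWeight_of_parts_eq_singleton (hlam : lam.parts = {n}) :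
    partitionWeight lam = 0 := by
  simp [partitionWeight, hlam]

theorem partitionWeight_of_parts_eq_replicate (hlam : lam.parts = Multiset.replicate n 1) :
    partitionWeight lam = n.choose 2 := by
  rw [partitionWeight, hlam, sort_replicate_one]
  exact sum_mapIdx_replicate_one n 0

theorem partitionWeight_of_parts_eq_cons (hlam : lam.parts = 2 ::ₘ Multiset.replicate k 1) :
    partitionWeight lam = (k + 1).choose 2 := by
  rw [partitionWeight, hlam,
    Multiset.sort_cons _ _ _ (by simp +contextual [Multiset.mem_replicate]), sort_replicate_one,
    List.mapIdx_cons, List.sum_cons, sum_mapIdx_replicate_one, Nat.choose_succ_succ' k 1,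
    Nat.choose_one_right]
  ring

theorem multFactorial_of_parts_eq_singleton (hlam : lam.parts = {n}) : multFactorial lam = 1 := by
  simp [multFactorial, hlam]

theorem multFactorial_eq_prod {s : Finset ℕ} (h : ∀ i ∈ lam.parts, i ∈ s) :
    multFactorial lam = ∏ j ∈ s, (lam.parts.count j).factorial := by
  refine Finset.prod_subset (fun i hi => h i (Multiset.mem_toFinset.1 hi)) fun i _ hi => ?_
  rw [Multiset.count_eq_zero_of_notMem (mt Multiset.mem_toFinset.2 hi), Nat.factorial_zero]

theorem multFactorial_of_parts_eq_replicate (hlam : lam.parts = Multiset.replicate n 1) :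
    multFactorial lam = n.factorial := by
  rw [multFactorial_eq_prod (s := {1}) (by simp +contextual [hlam, Multiset.mem_replicate]),
    Finset.prod_singleton, hlam, Multiset.count_replicate_self]

theorem multFactorial_of_parts_eq_cons (hlam : lam.parts = 2 ::ₘ Multiset.replicate k 1) :
    multFactorial lam = k.factorial := by
  rw [multFactorial_eq_prod (s := {1, 2}) (by simp +contextual [hlam, Multiset.mem_replicate]),
    Finset.prod_pair (by decide), hlam]
  simp [Multiset.count_replicate]

end Invariants

/-! ### The polynomials `J_λ` and `P_λ` of the three shapes -/

section Shapes

variable {n : ℕ} {lam : n.Partition} {J : ℚ[X]}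

theorem IsMonomialJ.monomialJ_eq (h : IsMonomialJ lam J) : monomialJ lam = J := by
  rw [monomialJ, show _ = _ from h]
  refine mul_div_cancel_left₀ J (mul_ne_zero (pow_ne_zero _ fun h0 => ?_) (pow_ne_zero _ X_ne_zero))
  simpa using congrArg (eval 0) h0

theorem IsMonomialJ.isMonomialJ_monomialJ (h : IsMonomialJ lam J) :
    IsMonomialJ lam (monomialJ lam) :=
  h.monomialJ_eq.symm ▸ h

theorem IsMonomialJ.polyP_eq (h : IsMonomialJ lam J) :
    polyP lam = C ((n : ℚ) / (multFactorial lam : ℚ)) * X ^ n * (1 + X) ^ partitionWeight lam *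
      J.comp (1 + X) := by
  rw [polyP, h.monomialJ_eq]

theorem isMonomialJ_of_parts_eq_singleton (hn : 1 ≤ n) (hlam : lam.parts = {n}) :
    IsMonomialJ lam (connectedExcessEnum (X - 1) n) := by
  obtain ⟨m, rfl⟩ := Nat.exists_eq_add_of_le' hn
  have hfac : C ((m.factorial : ℕ) : ℚ) * C (1 / (m.factorial : ℚ)) = 1 := by
    rw [← C_mul, mul_one_div_cancel (by positivity), C_1]
  have hpow : (1 - X : ℚ[X]) ^ m = (-1) ^ m * (X - 1) ^ m := by
    rw [← mul_pow, neg_one_mul, neg_sub]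
  rw [IsMonomialJ, specializedMonomial_of_parts_eq_singleton hlam, connectedEnum_eq_pow_mul,
    partitionWeight_of_parts_eq_singleton hlam, multFactorial_of_parts_eq_singleton hlam, hlam,
    Multiset.card_singleton, Nat.add_sub_cancel, mul_one, pow_zero, mul_one, hpow]
  linear_combination ((-1) ^ m * (X - 1) ^ m * connectedExcessEnum (X - 1) (m + 1)) * hfac

theorem isMonomialJ_of_parts_eq_replicate (hlam : lam.parts = Multiset.replicate n 1) :
    IsMonomialJ lam (C ((n - 1).factorial : ℚ)) := by
  rw [IsMonomialJ, specializedMonomial_of_parts_eq_replicate hlam,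
    partitionWeight_of_parts_eq_replicate hlam, multFactorial_of_parts_eq_replicate hlam, hlam,
    Multiset.card_replicate, Nat.sub_self, pow_zero, one_mul, ← mul_assoc, ← C_mul, mul_comm]
  congr 2
  push_cast
  field_simp

theorem isMonomialJ_of_parts_eq_cons (hlam : lam.parts = 2 ::ₘ Multiset.replicate (n - 2) 1) :
    IsMonomialJ lam (C ((n - 2).factorial : ℚ) * ∑ i ∈ Finset.range (n - 1), X ^ i) := by
  obtain ⟨m, rfl⟩ := Nat.exists_eq_add_of_le' (two_le_of_parts_eq_cons hlam)
  have hcard : m + 2 - lam.parts.card = 1 := by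
    rw [card_parts_of_parts_eq_cons hlam]
    omega
  have hfac : C ((((m + 1).factorial * m.factorial : ℕ) : ℚ)) * C (1 / ((m + 1).factorial : ℚ)) =
      C (m.factorial : ℚ) := by
    rw [← C_mul]
    congr 1
    push_cast
    field_simp
  have hgeom : (1 - X : ℚ[X]) * ∑ i ∈ Finset.range (m + 1), X ^ i = 1 - X ^ (m + 1) :=
    mul_neg_geom_sum X (m + 1)
  rw [IsMonomialJ, specializedMonomial_of_parts_eq_cons hlam, partitionWeight_of_parts_eq_cons hlam,
    multFactorial_of_parts_eq_cons hlam, hcard, pow_one]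
  simp only [Nat.add_sub_cancel, show m + 2 - 1 = m + 1 from rfl]
  linear_combination (X ^ (m + 1).choose 2 * (1 - X ^ (m + 1))) * hfac -
    (C (m.factorial : ℚ) * X ^ (m + 1).choose 2) * hgeom

theorem connectedExcessEnum_sub_one_comp (n : ℕ) :
    (connectedExcessEnum (X - 1 : ℚ[X]) n).comp (1 + X) = connectedExcessEnum X n := by
  have h := map_connectedExcessEnum (compRingHom (1 + X : ℚ[X])) (X - 1) n
  rwa [coe_compRingHom_apply, coe_compRingHom_apply, sub_comp, X_comp, one_comp,
    add_sub_cancel_left] at h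

theorem polyP_of_parts_eq_singleton (hn : 1 ≤ n) (hlam : lam.parts = {n}) :
    polyP lam = edgeEnumerator (rootDegreeGraphs n 1) := by
  rw [(isMonomialJ_of_parts_eq_singleton hn hlam).polyP_eq, connectedExcessEnum_sub_one_comp,
    partitionWeight_of_parts_eq_singleton hlam, multFactorial_of_parts_eq_singleton hlam,
    edgeEnumerator_rootDegreeGraphs_one, connectedEnum_eq_pow_mul, Nat.cast_one, div_one, pow_zero,
    mul_one, C_eq_natCast, ← mul_assoc X, mul_pow_sub_one (by omega), mul_assoc]

theorem polyP_of_parts_eq_replicate (hn : 1 ≤ n) (hlam : lam.parts = Multiset.replicate n 1) :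
    polyP lam = edgeEnumerator (rootDegreeGraphs n n) := by
  have hfac : C ((n : ℚ) / (n.factorial : ℚ)) * C ((n - 1).factorial : ℚ) = 1 := by
    rw [← C_mul, div_mul_eq_mul_div, ← Nat.cast_mul, Nat.mul_factorial_pred (by omega),
      div_self (by positivity), C_1]
  rw [(isMonomialJ_of_parts_eq_replicate hlam).polyP_eq, C_comp,
    partitionWeight_of_parts_eq_replicate hlam, multFactorial_of_parts_eq_replicate hlam,
    edgeEnumerator_rootDegreeGraphs_self]
  linear_combination (X ^ n * (1 + X) ^ n.choose 2) * hfac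

theorem polyP_of_parts_eq_cons (hlam : lam.parts = 2 ::ₘ Multiset.replicate (n - 2) 1) :
    polyP lam = edgeEnumerator (rootDegreeGraphs n (n - 1)) := by
  obtain ⟨m, rfl⟩ := Nat.exists_eq_add_of_le' (two_le_of_parts_eq_cons hlam)
  have hfac : C (((m + 2 : ℕ) : ℚ) / (m.factorial : ℚ)) * C (m.factorial : ℚ) =
      ((m + 2 : ℕ) : ℚ[X]) := by
    rw [← C_mul, div_mul_cancel₀ _ (by positivity), C_eq_natCast]
  have hgeom : X * ∑ i ∈ Finset.range (m + 1), (1 + X : ℚ[X]) ^ i = (1 + X) ^ (m + 1) - 1 := by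
    rw [← mul_geom_sum (1 + X : ℚ[X]) (m + 1), add_sub_cancel_left]
  rw [(isMonomialJ_of_parts_eq_cons hlam).polyP_eq, partitionWeight_of_parts_eq_cons hlam,
    multFactorial_of_parts_eq_cons hlam]
  simp only [Nat.add_sub_cancel, show m + 2 - 1 = m + 1 from rfl, mul_comp, C_comp,
    sum_comp, pow_comp, X_comp]
  rw [edgeEnumerator_rootDegreeGraphs_succ_self, Nat.choose_succ_succ' (m + 1) 1,
    Nat.choose_one_right, pow_add]
  linear_combination (X ^ (m + 2) * (1 + X) ^ (m + 1).choose 2 *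
    ∑ i ∈ Finset.range (m + 1), (1 + X : ℚ[X]) ^ i) * hfac +
    ((m + 2 : ℕ) : ℚ[X]) * X ^ (m + 1) * (1 + X) ^ (m + 1).choose 2 * hgeom

end Shapes

end

theorem mainTheorem2 (n : ℕ) (hn : 1 ≤ n) (lam : n.Partition) :
    (lam.parts = {n} ∨ lam.parts = Multiset.replicate n 1 ∨
        lam.parts = 2 ::ₘ Multiset.replicate (n - 2) 1 →
      IsMonomialJ lam (monomialJ lam) ∧ polyP lam = edgeEnumerator (dfsGraphs lam)) ∧
    (lam.parts = {n} → dfsGraphs lam = rootDegreeGraphs n 1) ∧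
    (lam.parts = Multiset.replicate n 1 → dfsGraphs lam = rootDegreeGraphs n n) ∧
    (lam.parts = 2 ::ₘ Multiset.replicate (n - 2) 1 →
      dfsGraphs lam = rootDegreeGraphs n (n - 1)) := by
  have graphs_singleton (h : lam.parts = {n}) : dfsGraphs lam = rootDegreeGraphs n 1 := by
    rw [(isDeterminedByLength_of_parts_eq_singleton h).dfsGraphs_eq hn, h, Multiset.card_singleton]
  have graphs_replicate (h : lam.parts = Multiset.replicate n 1) :
      dfsGraphs lam = rootDegreeGraphs n n := by
    rw [(isDeterminedByLength_of_parts_eq_replicate h).dfsGraphs_eq hn, h, Multiset.card_replicate]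
  have graphs_cons (h : lam.parts = 2 ::ₘ Multiset.replicate (n - 2) 1) :
      dfsGraphs lam = rootDegreeGraphs n (n - 1) := by
    rw [(isDeterminedByLength_of_parts_eq_cons h).dfsGraphs_eq hn, card_parts_of_parts_eq_cons h]
  refine ⟨?_, graphs_singleton, graphs_replicate, graphs_cons⟩
  rintro (h | h | h)
  · rw [graphs_singleton h]
    exact ⟨(isMonomialJ_of_parts_eq_singleton hn h).isMonomialJ_monomialJ,
      polyP_of_parts_eq_singleton hn h⟩
  · rw [graphs_replicate h]
    exact ⟨(isMonomialJ_of_parts_eq_replicate h).isMonomialJ_monomialJ,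
      polyP_of_parts_eq_replicate hn h⟩
  · rw [graphs_cons h]
    exact ⟨(isMonomialJ_of_parts_eq_cons h).isMonomialJ_monomialJ, polyP_of_parts_eq_cons h⟩
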